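/- Let $\mathbb K$ be $\mathbb R$ or $\mathbb C$, and let $X$ be a Tikhonov space (a completely regular Hausdorff topological space). Let $\mu_X$ be the fine uniformity of $X$, that is, the finest uniformity on the set $X$ that induces the given topology of $X$. Then there exist a Hilbert space $H$ over $\mathbb K$ (not necessarily separable), a set $I$ and a subset $S$ of the power $H^I$ such that the fine uniform space $(X,\mu_X)$ is uniformly isomorphic to $S$, where $H$ carries the uniformity of its norm, $H^I$ the product uniformity, and $S$ the uniformity induced from $H^I$. -/

import Mathlib

universe u

/-- The fine uniformity of a topological space: the infimum (in Mathlib's order smaller means finer)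
of all uniformities inducing the given topology. -/
@[reducible] def fineUniformity (X : Type u) [t : TopologicalSpace X] : UniformSpace X :=
  sInf {U : UniformSpace X | U.toTopologicalSpace = t}

/-- On a completely regular space the fine uniformity induces the topology and is the finest
uniformity which does so. -/
theorem fineUniformity_isLeast (X : Type u) [t : TopologicalSpace X] [CompletelyRegularSpace X] :
    IsLeast {U : UniformSpace X | U.toTopologicalSpace = t} (fineUniformity X) := by
  obtain ⟨U₀, hU₀⟩ := CompletelyRegularSpace.exists_uniformSpace (X := X)
  refine ⟨?_, fun U hU => UniformSpace.sInf_le hU⟩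
  change (sInf {U : UniformSpace X | U.toTopologicalSpace = t}).toTopologicalSpace = t
  rw [UniformSpace.toTopologicalSpace_sInf]
  exact le_antisymm (iInf₂_le_of_le U₀ hU₀ hU₀.le) (le_iInf₂ fun U hU => (Eq.symm hU).le)

/-!
The fine uniformity is characterized by two facts: every continuous map from `X` into a uniform
space is uniformly continuous for it, and it induces the topology of `X`. It is therefore enough to
find, for each entourage `V`, a continuous map `f` from `X` into one fixed Hilbert space such that
`‖f x - f y‖ < 1` implies `(x, y) ∈ V`. The diagonal product of these maps is then a uniform
embedding into a power of the Hilbert space.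

Such an `f` comes from Stone's theorem that pseudometrizable spaces are paracompact. The entourage
`V` belongs to a coarser, countably generated (hence pseudometrizable) uniformity
(`exists_isCountablyGenerated_uniformSpace_ge`). In that uniformity take a partition of unity `ρ`
subordinate to a cover by sets that are small of order `V`, and put `f x = (√(ρ i x))ᵢ` in `ℓ²`.
Local finiteness makes `f` continuous. All values are unit vectors; if `f x` and `f y` have
disjoint supports, then `‖f x - f y‖ ≥ ‖f x‖ = 1`, so points with `‖f x - f y‖ < 1` lie in a common
member of the cover. Indexing the cover by the points of `X` puts every `f` in the same space `ℓ²(X)`.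
-/

open Set Filter Topology Uniformity Function
open scoped SetRel

/-! ### Countably generated uniformities below a given one -/

/-- Every entourage of a uniform space is an entourage of some coarser uniformity with a countable
base: iterate the choice of a symmetric "square root" of the entourage. -/
theorem exists_isCountablyGenerated_uniformSpace_ge {X : Type*} (u : UniformSpace X)
    {V : SetRel X X} (hV : V ∈ 𝓤 X) :
    ∃ v : UniformSpace X, u ≤ v ∧ (𝓤[v]).IsCountablyGenerated ∧ V ∈ 𝓤[v] := by
  choose! r hr hsymm hcomp using
    fun (s : SetRel X X) (hs : s ∈ 𝓤 X) => comp_symm_mem_uniformity_sets hs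
  -- Start at `r V`, so that every `W n` is symmetric.
  let W : ℕ → SetRel X X := fun n => r^[n + 1] V
  have hsucc : ∀ n, W (n + 1) = r (W n) := fun n => iterate_succ_apply' r (n + 1) V
  have hW : ∀ n, W n ∈ 𝓤 X := fun n => by
    induction n with
    | zero => exact hr V hV
    | succ n ih => rw [hsucc]; exact hr _ ih
  have hWsymm : ∀ n, (W n).IsSymm := fun n => by
    cases n with
    | zero => exact hsymm V hV
    | succ n => rw [hsucc]; exact hsymm _ (hW n)
  have hWcomp : ∀ n, W (n + 1) ○ W (n + 1) ⊆ W n := fun n => by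
    rw [hsucc]; exact hcomp _ (hW n)
  have hsub : ∀ {s : SetRel X X}, s ∈ 𝓤 X → s ⊆ s ○ s := fun hs p hp =>
    ⟨p.1, refl_mem_uniformity hs, hp⟩
  have hanti : Antitone W := antitone_nat_of_succ_le fun n =>
    (hsub (hW (n + 1))).trans (hWcomp n)
  have hbasis : (⨅ n, 𝓟 (W n)).HasBasis (fun _ : ℕ => True) W :=
    hasBasis_iInf_principal hanti.directed_ge
  let c : UniformSpace.Core X :=
    { uniformity := ⨅ n, 𝓟 (W n)
      refl := le_iInf fun n => principal_mono.2 fun p hp => by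
        obtain ⟨x, y⟩ := p
        obtain rfl : x = y := hp
        exact refl_mem_uniformity (hW n)
      symm := (hbasis.tendsto_iff hbasis).2 fun n _ =>
        ⟨n, trivial, fun p hp => (hWsymm n).symm _ _ hp⟩
      comp := ((hbasis.lift' (monotone_id.relComp monotone_id)).le_basis_iff hbasis).2
        fun n _ => ⟨n + 1, trivial, hWcomp n⟩ }
  refine ⟨.ofCore c, ?_, ?_, ?_⟩
  · exact le_iInf fun n => le_principal_iff.2 (hW n)
  · exact hbasis.isCountablyGenerated
  · exact mem_of_superset (hbasis.mem_of_mem (i := 0) trivial)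
      ((hsub (hr V hV)).trans (hcomp V hV))

/-! ### Maps into `ℓ²` from partitions of unity -/

namespace PartitionOfUnity

variable (𝕜 : Type*) [RCLike 𝕜] {ι X : Type*} [TopologicalSpace X] (ρ : PartitionOfUnity ι X)

open Classical in
/-- The map into `ℓ²` whose coordinates are the square roots of the members of a partition of
unity. It is written as a locally finite sum of multiples of the standard unit vectors. -/
noncomputable def toEll2 (x : X) : lp (fun _ : ι => 𝕜) 2 :=
  ∑ᶠ i, lp.single 2 i ((√(ρ i x) : ℝ) : 𝕜)

theorem continuous_toEll2 : Continuous (ρ.toEll2 𝕜) := by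
  classical
  refine continuous_finsum (fun i => ?_) (ρ.locallyFinite.subset fun i x hx hx0 => hx ?_)
  · exact (lp.isometry_single (E := fun _ : ι => 𝕜) (p := 2) i).continuous.comp
      (RCLike.continuous_ofReal.comp (ρ i).continuous.sqrt)
  · simp [hx0]

theorem toEll2_apply (x : X) (i : ι) : ρ.toEll2 𝕜 x i = ((√(ρ i x) : ℝ) : 𝕜) := by
  classical
  have hsupp : support (fun j => lp.single (E := fun _ : ι => 𝕜) 2 j ((√(ρ j x) : ℝ) : 𝕜)) ⊆
      ρ.finsupport x := fun j hj => by
    rw [ρ.coe_finsupport]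
    exact fun h0 => hj (by simp [h0])
  rw [toEll2, finsum_eq_sum_of_support_subset _ hsupp, lp.coeFn_sum]
  simp only [Finset.sum_apply, lp.single_apply, Finset.sum_pi_single]
  split_ifs with h
  · rfl
  · rw [ρ.mem_finsupport, notMem_support] at h
    simp [h]

/-- Points whose images are at distance less than one lie in the support of a common member of the
partition of unity. -/
theorem exists_ne_zero_of_norm_toEll2_sub_lt_one {x y : X}
    (h : ‖ρ.toEll2 𝕜 x - ρ.toEll2 𝕜 y‖ < 1) : ∃ i, ρ i x ≠ 0 ∧ ρ i y ≠ 0 := by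
  by_contra! H
  -- The coordinates in the support of `x` alone contribute `∑ i, ρ i x = 1`.
  have hle := lp.sum_rpow_le_norm_rpow (p := 2) (by norm_num)
    (ρ.toEll2 𝕜 x - ρ.toEll2 𝕜 y) (ρ.finsupport x)
  have hsum : ∑ i ∈ ρ.finsupport x, ‖(ρ.toEll2 𝕜 x - ρ.toEll2 𝕜 y) i‖ ^ (2 : ENNReal).toReal = 1 := by
    rw [← ρ.sum_finsupport (mem_univ x)]
    refine Finset.sum_congr rfl fun i hi => ?_
    rw [ρ.mem_finsupport] at hi
    rw [lp.coeFn_sub, Pi.sub_apply, toEll2_apply, toEll2_apply, H i hi]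
    simp [Real.sq_sqrt (ρ.nonneg i x)]
  rw [hsum] at hle
  have : ‖ρ.toEll2 𝕜 x - ρ.toEll2 𝕜 y‖ ^ 2 < 1 := pow_lt_one₀ (norm_nonneg _) h two_ne_zero
  norm_num at hle this
  linarith

end PartitionOfUnity

/-- Here paracompactness of pseudometrizable spaces enters. The index set of `ℓ²` is `X` itself, since
the cover consists of one small neighbourhood for each point. -/
theorem exists_continuous_ell2_of_isCountablyGenerated (𝕜 : Type*) [RCLike 𝕜] {X : Type*}
    [UniformSpace X] [(𝓤 X).IsCountablyGenerated] {V : SetRel X X} (hV : V ∈ 𝓤 X) :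
    ∃ f : X → lp (fun _ : X => 𝕜) 2, Continuous f ∧ ∀ x y, ‖f x - f y‖ < 1 → (x, y) ∈ V := by
  have : ParacompactSpace X := by
    -- Paracompactness is a property of the topology, so any compatible pseudometric will do.
    let := UniformSpace.pseudoMetricSpace X
    infer_instance
  obtain ⟨W, hW, hWsymm, hWV⟩ := comp_symm_mem_uniformity_sets hV
  obtain ⟨ρ, hρ⟩ := PartitionOfUnity.exists_isSubordinate isClosed_univ
    (fun z : X => interior (UniformSpace.ball z W)) (fun _ => isOpen_interior)
    fun z _ => mem_iUnion.2 ⟨z, mem_interior_iff_mem_nhds.2 (UniformSpace.ball_mem_nhds z hW)⟩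
  refine ⟨ρ.toEll2 𝕜, ρ.continuous_toEll2 𝕜, fun x y hxy => ?_⟩
  obtain ⟨z, hx, hy⟩ := ρ.exists_ne_zero_of_norm_toEll2_sub_lt_one 𝕜 hxy
  have hball : ∀ {w}, ρ z w ≠ 0 → (z, w) ∈ W := fun hw =>
    interior_subset (s := UniformSpace.ball z W) (hρ z (subset_tsupport _ hw))
  exact hWV ⟨z, hWsymm.symm _ _ (hball hx), hball hy⟩

theorem exists_continuous_ell2 (𝕜 : Type*) [RCLike 𝕜] {X : Type*} [u : UniformSpace X]
    {V : SetRel X X} (hV : V ∈ 𝓤 X) :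
    ∃ f : X → lp (fun _ : X => 𝕜) 2, Continuous f ∧ ∀ x y, ‖f x - f y‖ < 1 → (x, y) ∈ V := by
  -- A map continuous for a coarser uniformity is continuous for the given one.
  obtain ⟨v, huv, hv, hVv⟩ := exists_isCountablyGenerated_uniformSpace_ge u hV
  obtain ⟨f, hf, hfV⟩ := @exists_continuous_ell2_of_isCountablyGenerated 𝕜 _ X v hv V hVv
  exact ⟨f, continuous_le_dom (UniformSpace.toTopologicalSpace_mono huv) hf, hfV⟩

/-! ### The fine uniformity -/

/-- The infimum of the fine uniformity and the uniformity pulled back along `f` still induces the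
topology of `X`, so the fine uniformity lies below it. -/
theorem Continuous.uniformContinuous_fineUniformity {X Y : Type*} [t : TopologicalSpace X]
    [CompletelyRegularSpace X] [uY : UniformSpace Y] {f : X → Y} (hf : Continuous f) :
    @UniformContinuous X Y (fineUniformity X) uY f := by
  have hfine := fineUniformity_isLeast X
  have hmem : fineUniformity X ⊓ uY.comap f ∈
      {U : UniformSpace X | U.toTopologicalSpace = t} := by
    change (fineUniformity X ⊓ uY.comap f).toTopologicalSpace = t
    rw [UniformSpace.toTopologicalSpace_inf, UniformSpace.toTopologicalSpace_comap, hfine.1]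
    exact inf_eq_left.2 hf.le_induced
  exact uniformContinuous_iff_le_comap.2 ((hfine.2 hmem).trans inf_le_right)

/-- Maps indexed by the entourages, each separating the pairs outside its entourage by a norm
distance of at least one, jointly induce the uniformity. -/
theorem isUniformInducing_pi_of_norm_sub_lt_one {X E : Type*} [UniformSpace X]
    [SeminormedAddCommGroup E] {f : {V : SetRel X X // V ∈ 𝓤 X} → X → E}
    (hf : ∀ V, UniformContinuous (f V)) (hfV : ∀ V x y, ‖f V x - f V y‖ < 1 → (x, y) ∈ V.1) :
    IsUniformInducing fun x V => f V x := by
  refine ⟨le_antisymm (fun V hV => ?_) (uniformContinuous_pi.2 hf).le_comap⟩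
  let e : {V : SetRel X X // V ∈ 𝓤 X} := ⟨V, hV⟩
  refine mem_comap.2 ⟨(fun p : (_ → E) × (_ → E) => (p.1 e, p.2 e)) ⁻¹' {q | dist q.1 q.2 < 1},
    ?_, fun p hp => ?_⟩
  · exact Pi.uniformContinuous_proj (fun _ => E) e (Metric.dist_mem_uniformity one_pos)
  · exact hfV e p.1 p.2 ((dist_eq_norm _ _).symm.trans_lt hp)

theorem mainTheorem3 (𝕜 : Type) [RCLike 𝕜] (X : Type u) [TopologicalSpace X] [T35Space X] :
    ∃ (H : Type u) (_ : NormedAddCommGroup H) (_ : InnerProductSpace 𝕜 H) (_ : CompleteSpace H)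
      (I : Type u) (S : Set (I → H)),
      Nonempty (@UniformEquiv X S (fineUniformity X) inferInstance) := by
  have htop := (fineUniformity_isLeast X).1
  have hT0 : @T0Space X (fineUniformity X).toTopologicalSpace := by
    rw [show (fineUniformity X).toTopologicalSpace = _ from htop]
    infer_instance
  have key : ∀ V : {V : SetRel X X // V ∈ 𝓤[fineUniformity X]},
      ∃ f : X → lp (fun _ : X => 𝕜) 2, Continuous f ∧ ∀ x y, ‖f x - f y‖ < 1 → (x, y) ∈ V.1 := by
    rintro ⟨V, hV⟩
    obtain ⟨f, hf, hfV⟩ := @exists_continuous_ell2 𝕜 _ X (fineUniformity X) V hV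
    rw [show (fineUniformity X).toTopologicalSpace = _ from htop] at hf
    exact ⟨f, hf, hfV⟩
  choose f hf hfV using key
  refine ⟨lp (fun _ : X => 𝕜) 2, inferInstance, inferInstance, inferInstance,
    {V : SetRel X X // V ∈ 𝓤[fineUniformity X]}, range fun x V => f V x, ⟨?_⟩⟩
  have hcont := fun V => (hf V).uniformContinuous_fineUniformity
  let := fineUniformity X
  exact .ofIsUniformEmbedding _ (isUniformInducing_pi_of_norm_sub_lt_one hcont hfV).isUniformEmbedding
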